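/- There are absolute constants $C>0$ and $k\in\mathbb N$ such that the following holds. Let $X$ be a finite totally ordered set, let $0<\varepsilon\le 1$ and $0<\delta<1$, and put $$f=\frac1\varepsilon\cdot\log\frac1\delta\cdot(\log^*|X|)^2 ,$$ where $\log^*x$ is the number of times the base-two logarithm has to be applied, starting from $x$, until the value is at most $1$. Then for every integer $n\ge 1$ with $$n\ \ge\ C\cdot f\cdot\bigl(\log(f+2)\bigr)^k$$ there is a randomized algorithm $\mathcal A:X^n\to X$ such that 1. $\mathcal A$ is $(\varepsilon,\delta)$-differentially private: for all databases $S,S'\in X^n$ that differ in a single entry and every $T\subseteq X$, $\Pr[\mathcal A(S)\in T]\le e^{\varepsilon}\Pr[\mathcal A(S')\in T]+\delta$; 2. $\mathcal A$ solves the interior point problem on $X$ with success probability $9/10$: for every $S\in X^n$, $\Pr[\min S\le\mathcal A(S)\le\max S]\ge 9/10$. In other words, the interior point problem on $X$ can be solved with $(\varepsilon,\delta)$-differential privacy and success probability $9/10$ with sample complexity $n=\tilde O\bigl(\frac1\varepsilon\cdot\log(\frac1\delta)\cdot(\log^*|X|)^2\bigr)$. -/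

import Mathlib

/-- Two databases of size `n` are neighboring if they differ in (at most) a single entry. -/
def Neighboring {X : Type*} {n : ℕ} (S S' : Fin n → X) : Prop :=
  ∃ i, ∀ j, j ≠ i → S j = S' j

/-- A randomized algorithm on databases in `X ^ n` with outcomes in `Y`, given by the output
distribution `A S` on every database `S`, is `(ε, δ)`-differentially private. -/
def IsDifferentiallyPrivate {X Y : Type*} {n : ℕ} (A : (Fin n → X) → PMF Y) (ε δ : ℝ) : Prop :=
  ∀ S S' : Fin n → X, Neighboring S S' → ∀ T : Set Y,
    (A S).toOuterMeasure T ≤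
      ENNReal.ofReal (Real.exp ε) * (A S').toOuterMeasure T + ENNReal.ofReal δ

/-- `y` is an interior point of the database `S`, that is, `min S ≤ y ≤ max S`. -/
def IsInteriorPoint {X : Type*} [LinearOrder X] {n : ℕ} (S : Fin n → X) (y : X) : Prop :=
  (∃ i, S i ≤ y) ∧ (∃ j, y ≤ S j)

/-- The randomized algorithm `A` solves the interior point problem over `X` with sample
complexity `n` and failure probability `β`. -/
def SolvesInteriorPoint {X : Type*} [LinearOrder X] {n : ℕ}
    (A : (Fin n → X) → PMF X) (β : ℝ) : Prop :=
  ∀ S : Fin n → X, ENNReal.ofReal (1 - β) ≤ (A S).toOuterMeasure {y | IsInteriorPoint S y}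

/-- The iterated logarithm `log* x`: the number of times the base-two logarithm has to be applied,
starting from `x`, until the value is at most `1`. -/
noncomputable def logStar (x : ℝ) : ℕ :=
  sInf {k : ℕ | (Real.logb 2)^[k] x ≤ 1}

/-- The main term `(1 / ε) * log (1 / δ) * (log* N) ^ 2` of the sample complexity for a domain
of size `N`. -/
noncomputable def sampleTerm (ε δ : ℝ) (N : ℕ) : ℝ :=
  (1 / ε) * Real.log (1 / δ) * (logStar (N : ℝ) : ℝ) ^ 2

/-! The proof is a recursion along the tower of twos: a mechanism on {0, ..., d - 1} yields one on
{0, ..., 2 ^ d - 1}, the leaves of a binary tree of height d. A random path p from the root prefers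
the heavier child. Each entry leaves p at some height; these heights, without the 5t + 1 smallest
and the 2t largest, form a database over {0, ..., d - 1}, for which the given mechanism returns an
interior point g. The trimming forces the node of p at height g to hold at least t entries, while
enough entries lie outside it that one of its endpoints has depth at least t (`le_depth_endpoint`).
A noisy comparison of depths picks an endpoint.

All choices are logistic coins made deterministic beyond a margin t, so success has probability one.
Privacy relies on this as well: below a node of weight at most 5t + 1 the trimmed heights and the
output no longer depend on the path (`liftMechanism_const`). Above such nodes a coin costs privacy
only where the children are balanced up to about t; the weight then roughly halves, so this happens
at most r times, with r logarithmic in the ratio of the database size to t (`heavyPath_le`).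

One lifting thus costs (r + 1)ε₁ in privacy and 7t + 1 entries. With L = log* |X| liftings, ε₁ = ε /
(2L(r + 1)) and t about log(1/δ₁) / ε₁, the total L * t is L² log(1/δ) / ε up to logarithmic
factors. -/

/-! ### Finitely additive distributions -/

/-- A finitely additive probability distribution on `Y`, given by its expectation functional. -/
structure Expectation (Y : Type*) where
  E : (Y → ℝ) →ₗ[ℝ] ℝ
  nonneg : ∀ f, (∀ y, 0 ≤ f y) → 0 ≤ E f
  one : E (fun _ => 1) = 1

namespace Expectation

variable {Y Z : Type*}

theorem const (P : Expectation Y) (c : ℝ) : P.E (fun _ => c) = c := by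
  have h : (fun _ : Y => c) = c • (fun _ : Y => (1 : ℝ)) := by ext; simp
  rw [h, map_smul, P.one]; simp

theorem mono (P : Expectation Y) {f g : Y → ℝ} (h : ∀ y, f y ≤ g y) : P.E f ≤ P.E g := by
  have := P.nonneg (g - f) (fun y => sub_nonneg.2 (h y))
  rw [map_sub] at this
  linarith

theorem affine (P : Expectation Y) (c b : ℝ) (f : Y → ℝ) :
    P.E (fun y => c * f y + b) = c * P.E f + b := by
  have h : (fun y => c * f y + b) = c • f + fun _ => b := by ext; simp
  rw [h, map_add, map_smul, P.const]; simp

theorem le_affine (P : Expectation Y) {c b : ℝ} {f g : Y → ℝ} (h : ∀ y, f y ≤ c * g y + b) :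
    P.E f ≤ c * P.E g + b := by
  rw [← P.affine]; exact P.mono h

theorem le_one (P : Expectation Y) {f : Y → ℝ} (h : ∀ y, f y ≤ 1) : P.E f ≤ 1 := by
  rw [← P.one]; exact P.mono h

/-- The predicate `Q` holds almost surely. -/
def AlmostSurely (P : Expectation Y) (Q : Y → Prop) : Prop :=
  ∀ f g : Y → ℝ, (∀ y, Q y → f y ≤ g y) → P.E f ≤ P.E g

theorem AlmostSurely.congr {P : Expectation Y} {Q : Y → Prop} (h : P.AlmostSurely Q)
    {f g : Y → ℝ} (hfg : ∀ y, Q y → f y = g y) : P.E f = P.E g :=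
  le_antisymm (h _ _ fun y hy => (hfg y hy).le) (h _ _ fun y hy => (hfg y hy).ge)

theorem AlmostSurely.eq_const {P : Expectation Y} {Q : Y → Prop} (h : P.AlmostSurely Q)
    {f : Y → ℝ} {c : ℝ} (hf : ∀ y, Q y → f y = c) : P.E f = c := by
  rw [h.congr hf, P.const]

/-- The point mass at `y`. -/
def pure (y : Y) : Expectation Y where
  E := LinearMap.proj y
  nonneg _ h := h y
  one := rfl

@[simp] theorem pure_E (y : Y) (f : Y → ℝ) : (pure y).E f = f y := rfl

/-- Sampling from a randomly chosen distribution. -/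
def bind (P : Expectation Y) (Q : Y → Expectation Z) : Expectation Z where
  E := P.E ∘ₗ LinearMap.pi fun y => (Q y).E
  nonneg f h := P.nonneg _ fun y => (Q y).nonneg f h
  one := by
    change P.E (fun y => (Q y).E fun _ => 1) = 1
    simp [Expectation.one]

@[simp] theorem bind_E (P : Expectation Y) (Q : Y → Expectation Z) (f : Z → ℝ) :
    (P.bind Q).E f = P.E fun y => (Q y).E f := rfl

/-- The mixture of `P` and `Q` with weights `p` and `1 - p`. -/
def mix (p : Set.Icc (0 : ℝ) 1) (P Q : Expectation Y) : Expectation Y where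
  E := (p : ℝ) • P.E + (1 - p : ℝ) • Q.E
  nonneg f h := by
    have := mul_nonneg p.2.1 (P.nonneg f h)
    have := mul_nonneg (sub_nonneg.2 p.2.2) (Q.nonneg f h)
    simp; linarith
  one := by simp [Expectation.one]

@[simp] theorem mix_E (p : Set.Icc (0 : ℝ) 1) (P Q : Expectation Y) (f : Y → ℝ) :
    (mix p P Q).E f = p * P.E f + (1 - p) * Q.E f := by simp [mix]

theorem AlmostSurely.mix {p : Set.Icc (0 : ℝ) 1} {P Q : Expectation Y} {R : Y → Prop}
    (hP : (p : ℝ) ≠ 0 → P.AlmostSurely R) (hQ : (p : ℝ) ≠ 1 → Q.AlmostSurely R) :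
    (mix p P Q).AlmostSurely R := by
  intro f g hfg
  have h1 : (p : ℝ) * P.E f ≤ p * P.E g := by
    by_cases h : (p : ℝ) = 0
    · simp [h]
    · exact mul_le_mul_of_nonneg_left (hP h f g hfg) p.2.1
  have h2 : (1 - p : ℝ) * Q.E f ≤ (1 - p) * Q.E g := by
    by_cases h : (p : ℝ) = 1
    · simp [h]
    · exact mul_le_mul_of_nonneg_left (hQ h f g hfg) (sub_nonneg.2 p.2.2)
  simpa using add_le_add h1 h2

theorem AlmostSurely.pure {y : Y} {R : Y → Prop} (h : R y) : (pure y).AlmostSurely R :=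
  fun _ _ hfg => hfg y h

theorem AlmostSurely.mono {P : Expectation Y} {Q R : Y → Prop} (h : P.AlmostSurely Q)
    (hQR : ∀ y, Q y → R y) : P.AlmostSurely R :=
  fun f g hfg => h f g fun y hy => hfg y (hQR y hy)

theorem AlmostSurely.bind {P : Expectation Y} {Q : Y → Expectation Z} {A : Y → Prop}
    {B : Z → Prop} (hP : P.AlmostSurely A) (hQ : ∀ y, A y → (Q y).AlmostSurely B) :
    (P.bind Q).AlmostSurely B :=
  fun f g hfg => hP _ _ fun y hy => hQ y hy f g hfg

end Expectation

/-! ### Truncated logistic coins -/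

/-- The logistic function of `ε * x`. -/
noncomputable def logistic (ε : ℝ) (x : ℤ) : ℝ := 1 / (1 + Real.exp (-(ε * x)))

theorem logistic_nonneg (ε : ℝ) (x : ℤ) : 0 ≤ logistic ε x := by
  unfold logistic; positivity

theorem one_sub_logistic (ε : ℝ) (x : ℤ) : 1 - logistic ε x = logistic ε (-x) := by
  unfold logistic
  have h1 : Real.exp (-(ε * x)) * Real.exp (ε * x) = 1 := by rw [← Real.exp_add]; simp
  have h2 := Real.exp_pos (-(ε * x))
  have h3 := Real.exp_pos (ε * x)
  push_cast
  rw [mul_neg, neg_neg]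
  field_simp
  linear_combination h1

theorem logistic_le_one (ε : ℝ) (x : ℤ) : logistic ε x ≤ 1 := by
  have := logistic_nonneg ε (-x)
  rw [← one_sub_logistic] at this
  linarith

theorem logistic_le_exp (ε : ℝ) (x : ℤ) : logistic ε x ≤ Real.exp (ε * x) := by
  unfold logistic
  have h1 : Real.exp (-(ε * x)) * Real.exp (ε * x) = 1 := by rw [← Real.exp_add]; simp
  have h3 := Real.exp_pos (ε * x)
  rw [div_le_iff₀ (by positivity)]
  nlinarith

theorem logistic_le_mul {ε : ℝ} (hε : 0 ≤ ε) {x y : ℤ} (h : x ≤ y + 1) :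
    logistic ε x ≤ Real.exp ε * logistic ε y := by
  unfold logistic
  have hx := Real.exp_pos (-(ε * x))
  have hy := Real.exp_pos (-(ε * y))
  have h' : (x : ℝ) ≤ y + 1 := by exact_mod_cast h
  have h1 : Real.exp (-(ε * y)) ≤ Real.exp ε * Real.exp (-(ε * x)) := by
    rw [← Real.exp_add]
    apply Real.exp_le_exp.2
    nlinarith
  have h2 : 1 ≤ Real.exp ε := Real.one_le_exp hε
  rw [mul_one_div, div_le_div_iff₀ (by positivity) (by positivity)]
  nlinarith

/-- A coin whose bias is the logistic function of `ε * x` for `|x| < t` and which is deterministic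
for larger `|x|`. -/
noncomputable def truncatedLogistic (ε : ℝ) (t : ℕ) (x : ℤ) : Set.Icc (0 : ℝ) 1 :=
  if (t : ℤ) ≤ x then 1 else if x ≤ -t then 0 else
    ⟨logistic ε x, logistic_nonneg ε x, logistic_le_one ε x⟩

theorem truncatedLogistic_of_le {ε : ℝ} {t : ℕ} {x : ℤ} (h : (t : ℤ) ≤ x) :
    truncatedLogistic ε t x = 1 := by simp [truncatedLogistic, h]

theorem truncatedLogistic_of_le_neg {ε : ℝ} {t : ℕ} (ht : 1 ≤ t) {x : ℤ} (h : x ≤ -t) :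
    truncatedLogistic ε t x = 0 := by
  have : ¬ (t : ℤ) ≤ x := by omega
  simp [truncatedLogistic, h, this]

theorem abs_truncatedLogistic_sub_le {ε δ : ℝ} (hε : 0 ≤ ε) {t : ℕ}
    (hδ : Real.exp (-(ε * t)) ≤ δ) (x : ℤ) :
    |(truncatedLogistic ε t x : ℝ) - logistic ε x| ≤ δ := by
  have h0 : 0 ≤ δ := (Real.exp_pos _).le.trans hδ
  have key : ∀ z : ℤ, z ≤ -t → logistic ε z ≤ δ := fun z hz => by
    have hz' : (z : ℝ) ≤ -t := by exact_mod_cast hz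
    refine (logistic_le_exp ε z).trans (le_trans (Real.exp_le_exp.2 ?_) hδ)
    nlinarith
  unfold truncatedLogistic
  split_ifs with h1 h2
  · have := key (-x) (by omega)
    rw [← one_sub_logistic] at this
    rw [abs_le]
    have := logistic_le_one ε x
    constructor <;> simp <;> linarith
  · have := key x h2
    have := logistic_nonneg ε x
    rw [abs_le]
    constructor <;> simp <;> linarith
  · simpa using h0

/-- Moving the argument by one changes the logistic bias and its complement by a factor of at most
e^ε. Truncation shifts each bias by at most δ, so each outcome loses δ + e^ε δ ≤ 4δ, and the two
outcomes together 8δ. -/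
theorem truncatedLogistic_mix_le {ε δ : ℝ} (hε : 0 ≤ ε) (hε1 : ε ≤ 1) {t : ℕ}
    (hδ : Real.exp (-(ε * t)) ≤ δ) {x y : ℤ} (hxy : |x - y| ≤ 1) {a b : ℝ}
    (ha0 : 0 ≤ a) (ha : a ≤ 1) (hb0 : 0 ≤ b) (hb : b ≤ 1) :
    (truncatedLogistic ε t x : ℝ) * a + (1 - truncatedLogistic ε t x) * b ≤
      Real.exp ε * (truncatedLogistic ε t y * a + (1 - truncatedLogistic ε t y) * b) +
        8 * δ := by
  rw [abs_le] at hxy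
  have h1 := logistic_le_mul hε (show x ≤ y + 1 by omega)
  have h2 := logistic_le_mul hε (show -x ≤ -y + 1 by omega)
  rw [← one_sub_logistic, ← one_sub_logistic] at h2
  obtain ⟨hx1, hx2⟩ := abs_le.1 (abs_truncatedLogistic_sub_le hε hδ x)
  obtain ⟨hy1, hy2⟩ := abs_le.1 (abs_truncatedLogistic_sub_le hε hδ y)
  have he : Real.exp ε ≤ 3 :=
    (Real.exp_le_exp.2 hε1).trans (by have := Real.exp_one_lt_d9; linarith)
  have he0 := Real.exp_pos ε
  have h0 : 0 ≤ δ := (Real.exp_pos _).le.trans hδ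
  generalize (truncatedLogistic ε t x : ℝ) = p at *
  generalize (truncatedLogistic ε t y : ℝ) = q at *
  generalize Real.exp ε = e at *
  have hp : p ≤ e * q + 4 * δ := by nlinarith
  have hp' : 1 - p ≤ e * (1 - q) + 4 * δ := by nlinarith
  nlinarith [mul_le_mul_of_nonneg_right hp ha0, mul_le_mul_of_nonneg_right hp' hb0]

/-! ### Trimming sorted multisets -/

namespace List

/-- An element inserted among the first k pushes one old element over the cut; otherwise it survives
itself. This makes trimming stable under adding an entry. -/
theorem exists_drop_orderedInsert_perm {α : Type*} (r : α → α → Prop) [DecidableRel r] (a : α)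
    (l : List α) (k : ℕ) (hk : k ≤ l.length) :
    ∃ b, ((l.orderedInsert r a).drop k).Perm (b :: l.drop k) := by
  induction k generalizing l with
  | zero => exact ⟨a, by simpa using List.perm_orderedInsert r a l⟩
  | succ k ih =>
    cases l with
    | nil => simp at hk
    | cons x l =>
      by_cases h : r a x
      · rw [List.orderedInsert_cons_of_le _ _ h]
        simp only [List.drop_succ_cons]
        cases k with
        | zero => exact ⟨x, by simp⟩
        | succ k =>
          simp only [List.length_cons] at hk
          refine ⟨l[k]'(by omega), ?_⟩
          rw [List.drop_succ_cons, ← List.drop_eq_getElem_cons]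
      · rw [List.orderedInsert_of_not_le _ _ h]
        simp only [List.drop_succ_cons]
        exact ih l (by simpa using hk)

end List

namespace Multiset

variable {α : Type*} (r : α → α → Prop) [DecidableRel r] [IsTrans α r] [Std.Antisymm r] [Std.Total r]

/-- Remove the `k` smallest elements, with respect to the total order `r`. -/
noncomputable def trim (k : ℕ) (s : Multiset α) : Multiset α := ((s.sort r).drop k : List α)

theorem card_trim (k : ℕ) (s : Multiset α) : card (s.trim r k) = card s - k := by
  simp [trim]

theorem trim_le (k : ℕ) (s : Multiset α) : s.trim r k ≤ s := by
  conv_rhs => rw [← s.sort_eq r]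
  exact coe_le.2 (List.drop_sublist _ _).subperm

theorem sort_eq_of_perm {s : Multiset α} {l : List α} (hl : l.Pairwise r) (h : (l : Multiset α) = s) :
    s.sort r = l := by
  refine List.Perm.eq_of_pairwise (le := r) (fun a b _ _ => antisymm_of r) (s.pairwise_sort r) hl ?_
  rw [← coe_eq_coe, h, sort_eq]

theorem exists_trim_cons (k : ℕ) (a : α) (s : Multiset α) (hk : k ≤ card s) :
    ∃ b, (a ::ₘ s).trim r k = b ::ₘ s.trim r k := by
  obtain ⟨b, hb⟩ := List.exists_drop_orderedInsert_perm r a (s.sort r) k (by simpa using hk)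
  refine ⟨b, ?_⟩
  have : (a ::ₘ s).sort r = (s.sort r).orderedInsert r a := by
    apply sort_eq_of_perm
    · exact (s.pairwise_sort r).orderedInsert a _
    · rw [coe_eq_coe.2 (List.perm_orderedInsert r a _), ← cons_coe, sort_eq]
  rw [trim, trim, this, cons_coe, coe_eq_coe]
  exact hb

theorem lt_countP_of_mem_trim {k : ℕ} {s : Multiset α} {y : α} (hy : y ∈ s.trim r k) :
    k < s.countP (fun x => r x y) := by
  have h1 : s.countP (fun x => r x y) = (s.sort r).countP (fun x => r x y) := by
    conv_lhs => rw [← s.sort_eq r]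
    rw [coe_countP]
  have hy' : y ∈ (s.sort r).drop k := hy
  have hk : k < (s.sort r).length := by
    by_contra h
    rw [List.drop_eq_nil_of_le (by omega)] at hy'
    simp at hy'
  have hs := s.pairwise_sort r
  rw [h1]
  rw [← List.take_append_drop k (s.sort r)] at hs ⊢
  rw [List.countP_append]
  have h2 : ((s.sort r).take k).countP (fun x => r x y) = k := by
    rw [List.countP_eq_length.2, List.length_take, min_eq_left hk.le]
    intro x hx
    simpa using (List.pairwise_append.1 hs).2.2 x hx y hy'
  have h3 : 0 < ((s.sort r).drop k).countP (fun x => r x y) :=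
    List.countP_pos_iff.2 ⟨y, hy', by simpa using refl_of r y⟩
  omega

theorem trim_add (k : ℕ) (s u : Multiset α) (h : ∀ x ∈ s, ∀ y ∈ u, r x y) (hk : card s ≤ k) :
    (s + u).trim r k = u.trim r (k - card s) := by
  have : (s + u).sort r = s.sort r ++ u.sort r := by
    apply sort_eq_of_perm
    · refine List.pairwise_append.2 ⟨s.pairwise_sort r, u.pairwise_sort r, fun x hx y hy => ?_⟩
      exact h x (by simpa using hx) y (by simpa using hy)
    · rw [← coe_add, sort_eq, sort_eq]
  rw [trim, this, List.drop_append, List.drop_eq_nil_of_le (by simpa using hk), trim]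
  simp

end Multiset

/-! ### Fork heights along a path in the binary tree -/

/-- The least `g` such that the ancestors of the leaves `p` and `x` of the infinite binary tree
agree at height `g + 1`. -/
noncomputable def forkHeight (p x : ℕ) : ℕ := sInf {g | x / 2 ^ (g + 1) = p / 2 ^ (g + 1)}

theorem div_two_pow_eq_of_le {x y h g : ℕ} (hg : h ≤ g) (e : x / 2 ^ h = y / 2 ^ h) :
    x / 2 ^ g = y / 2 ^ g := by
  obtain ⟨c, rfl⟩ := Nat.exists_eq_add_of_le hg
  rw [pow_add, ← Nat.div_div_eq_div_mul, ← Nat.div_div_eq_div_mul, e]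

theorem forkHeight_le_iff {p x g : ℕ} :
    forkHeight p x ≤ g ↔ x / 2 ^ (g + 1) = p / 2 ^ (g + 1) := by
  constructor
  · intro h
    have hne : {g | x / 2 ^ (g + 1) = p / 2 ^ (g + 1)}.Nonempty := by
      -- At this height both ancestors are the node 0. Nonemptiness matters since `sInf ∅ = 0`.
      refine ⟨x + p, ?_⟩
      have h1 : x + p + 1 < 2 ^ (x + p + 1) := Nat.lt_two_pow_self
      change x / 2 ^ (x + p + 1) = p / 2 ^ (x + p + 1)
      rw [Nat.div_eq_of_lt (by omega), Nat.div_eq_of_lt (by omega)]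
    exact div_two_pow_eq_of_le (Nat.succ_le_succ h) (Nat.sInf_mem hne)
  · intro h
    exact Nat.sInf_le h

theorem forkHeight_congr {p p' x h : ℕ} (hp : p / 2 ^ h = p' / 2 ^ h)
    (hx : x / 2 ^ h ≠ p / 2 ^ h) : forkHeight p x = forkHeight p' x := by
  apply eq_of_forall_ge_iff
  intro g
  rw [forkHeight_le_iff, forkHeight_le_iff]
  rcases le_or_gt h (g + 1) with hg | hg
  · rw [div_two_pow_eq_of_le hg hp]
  · constructor
    · intro e
      exact absurd (div_two_pow_eq_of_le hg.le e) hx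
    · intro e
      exact absurd ((div_two_pow_eq_of_le hg.le e).trans hp.symm) hx

theorem le_forkHeight {p x h : ℕ} (hx : x / 2 ^ h ≠ p / 2 ^ h) : h ≤ forkHeight p x := by
  by_contra hlt
  exact hx (div_two_pow_eq_of_le (by omega) (forkHeight_le_iff.1 le_rfl))

theorem forkHeight_lt {d p x : ℕ} (hd : 1 ≤ d) (hp : p < 2 ^ d) (hx : x < 2 ^ d) :
    forkHeight p x < d := by
  have : forkHeight p x ≤ d - 1 := by
    rw [forkHeight_le_iff, Nat.sub_add_cancel hd, Nat.div_eq_of_lt hp, Nat.div_eq_of_lt hx]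
  omega

/-- The heights at which the elements of `s` leave the path to the leaf `p`, without the `k`
smallest and the `m` largest ones. -/
noncomputable def forkDatabase (k m : ℕ) (s : Multiset ℕ) (p : ℕ) : Multiset ℕ :=
  ((s.map (forkHeight p)).trim (· ≤ ·) k).trim (· ≥ ·) m

/-- The number of elements of `s` below the node `v` of height `h`. -/
def nodeWeight (s : Multiset ℕ) (h v : ℕ) : ℕ := s.countP (fun x => x / 2 ^ h = v)

theorem card_forkDatabase (k m : ℕ) (s : Multiset ℕ) (p : ℕ) :
    (forkDatabase k m s p).card = s.card - k - m := by
  rw [forkDatabase, Multiset.card_trim, Multiset.card_trim, Multiset.card_map]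

theorem exists_forkDatabase_cons (k m : ℕ) (a : ℕ) (s : Multiset ℕ) (p : ℕ)
    (h : k + m ≤ s.card) :
    ∃ b, forkDatabase k m (a ::ₘ s) p = b ::ₘ forkDatabase k m s p := by
  unfold forkDatabase
  rw [Multiset.map_cons]
  obtain ⟨b, hb⟩ := Multiset.exists_trim_cons (· ≤ ·) k (forkHeight p a) (s.map (forkHeight p))
    (by rw [Multiset.card_map]; omega)
  rw [hb]
  exact Multiset.exists_trim_cons _ _ _ _
    (by rw [Multiset.card_trim, Multiset.card_map]; omega)

theorem exists_of_mem_forkDatabase {k m : ℕ} {s : Multiset ℕ} {p g : ℕ}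
    (h : g ∈ forkDatabase k m s p) : ∃ x ∈ s, forkHeight p x = g := by
  have := Multiset.mem_of_le (Multiset.trim_le _ _ _) (Multiset.mem_of_le (Multiset.trim_le _ _ _) h)
  simpa using this

theorem nodeWeight_eq_countP_forkHeight (s : Multiset ℕ) (p g : ℕ) :
    nodeWeight s (g + 1) (p / 2 ^ (g + 1)) = (s.map (forkHeight p)).countP (· ≤ g) := by
  rw [nodeWeight, Multiset.countP_map, Multiset.countP_eq_card_filter]
  simp only [forkHeight_le_iff]

theorem lt_nodeWeight_of_forkDatabase {k m : ℕ} {s : Multiset ℕ} {p g y : ℕ}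
    (hy : y ∈ forkDatabase k m s p) (hg : y ≤ g) :
    k < nodeWeight s (g + 1) (p / 2 ^ (g + 1)) := by
  have h1 := Multiset.lt_countP_of_mem_trim _ (Multiset.mem_of_le (Multiset.trim_le _ _ _) hy)
  rw [nodeWeight_eq_countP_forkHeight]
  refine h1.trans_le ?_
  rw [Multiset.countP_eq_card_filter, Multiset.countP_eq_card_filter]
  exact Multiset.card_le_card (Multiset.monotone_filter_right _ fun x hx => hx.trans hg)

theorem lt_countP_of_forkDatabase {k m : ℕ} {s : Multiset ℕ} {p g y : ℕ}
    (hy : y ∈ forkDatabase k m s p) (hg : g ≤ y) :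
    m < s.countP (fun x => g ≤ forkHeight p x) := by
  have h1 := Multiset.lt_countP_of_mem_trim _ hy
  refine h1.trans_le ((Multiset.countP_le_of_le _ (Multiset.trim_le _ _ _)).trans ?_)
  rw [Multiset.countP_map, Multiset.countP_eq_card_filter]
  exact Multiset.card_le_card (Multiset.monotone_filter_right _ fun x hx => le_trans hg hx)

/-- Entries below the common node fork below height h and all others at height h or more, so the at
most k former ones are trimmed away. The fork heights of the others depend only on the path above
the node. -/
theorem forkDatabase_congr {k m : ℕ} {s : Multiset ℕ} {p p' h : ℕ}
    (hp : p / 2 ^ h = p' / 2 ^ h) (hk : nodeWeight s h (p / 2 ^ h) ≤ k) :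
    forkDatabase k m s p = forkDatabase k m s p' := by
  unfold forkDatabase
  rcases Nat.eq_zero_or_pos h with rfl | hpos
  · simp only [pow_zero, Nat.div_one] at hp
    rw [hp]
  congr 1
  rw [nodeWeight, Multiset.countP_eq_card_filter] at hk
  have split : ∀ q, q / 2 ^ h = p / 2 ^ h → (s.map (forkHeight q)).trim (· ≤ ·) k =
      ((s.filter fun x => ¬ x / 2 ^ h = p / 2 ^ h).map (forkHeight q)).trim (· ≤ ·)
        (k - (s.filter fun x => x / 2 ^ h = p / 2 ^ h).card) := by
    intro q hq
    conv_lhs => rw [← Multiset.filter_add_not (fun x => x / 2 ^ h = p / 2 ^ h) s, Multiset.map_add]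
    rw [Multiset.trim_add, Multiset.card_map]
    · intro a ha b hb
      rw [Multiset.mem_map] at ha hb
      obtain ⟨x, hx, rfl⟩ := ha
      obtain ⟨y, hy, rfl⟩ := hb
      rw [Multiset.mem_filter] at hx hy
      have h1 : forkHeight q x ≤ h - 1 := by
        rw [forkHeight_le_iff, Nat.sub_add_cancel hpos, hx.2, hq]
      have h2 : h ≤ forkHeight q y := le_forkHeight (by rw [hq]; exact hy.2)
      omega
    · rwa [Multiset.card_map]
  rw [split p rfl, split p' hp.symm]
  congr 1
  refine Multiset.map_congr rfl fun x hx => ?_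
  exact forkHeight_congr hp (Multiset.mem_filter.1 hx).2

theorem nodeWeight_succ (s : Multiset ℕ) (h v : ℕ) :
    nodeWeight s (h + 1) v = nodeWeight s h (2 * v) + nodeWeight s h (2 * v + 1) := by
  induction s using Multiset.induction with
  | empty => simp [nodeWeight]
  | cons a s ih =>
    simp only [nodeWeight, Multiset.countP_cons] at ih ⊢
    rw [ih, pow_succ, ← Nat.div_div_eq_div_mul]
    split_ifs <;> omega

theorem nodeWeight_cons (a : ℕ) (s : Multiset ℕ) (h v : ℕ) :
    nodeWeight (a ::ₘ s) h v = nodeWeight s h v + if a / 2 ^ h = v then 1 else 0 := by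
  simp only [nodeWeight, Multiset.countP_cons]

theorem nodeWeight_le_card (s : Multiset ℕ) (h v : ℕ) : nodeWeight s h v ≤ s.card :=
  Multiset.countP_le_card _ _

theorem nodeWeight_mono {s : Multiset ℕ} {h g p : ℕ} (hg : g ≤ h) :
    nodeWeight s g (p / 2 ^ g) ≤ nodeWeight s h (p / 2 ^ h) := by
  rw [nodeWeight, nodeWeight, Multiset.countP_eq_card_filter, Multiset.countP_eq_card_filter]
  exact Multiset.card_le_card
    (Multiset.monotone_filter_right _ fun x hx => div_two_pow_eq_of_le hg hx)

/-! ### The random heavy path and its privacy -/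

/-- The difference of the weights of the two children of the node `v` of height `h + 1`. -/
def nodeBalance (s : Multiset ℕ) (h v : ℕ) : ℤ :=
  (nodeWeight s h (2 * v) : ℤ) - nodeWeight s h (2 * v + 1)

theorem abs_nodeBalance_cons (a : ℕ) (s : Multiset ℕ) (h v : ℕ) :
    |nodeBalance (a ::ₘ s) h v - nodeBalance s h v| ≤ 1 := by
  unfold nodeBalance
  rw [nodeWeight_cons, nodeWeight_cons, abs_le]
  push_cast
  split_ifs <;> omega

/-- A random path from the node `v` of height `h` to a leaf, preferring the heavier child. -/
noncomputable def heavyPath (ε : ℝ) (t : ℕ) (s : Multiset ℕ) : ℕ → ℕ → Expectation ℕ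
  | 0, v => .pure v
  | h + 1, v => .mix (truncatedLogistic ε t (nodeBalance s h v))
      (heavyPath ε t s h (2 * v)) (heavyPath ε t s h (2 * v + 1))

theorem div_two_pow_succ_eq {p h v w : ℕ} (hp : p / 2 ^ h = w) (hw : w / 2 = v) :
    p / 2 ^ (h + 1) = v := by
  rw [pow_succ, ← Nat.div_div_eq_div_mul, hp, hw]

/-- A child entered with positive probability is lighter than its sibling by less than t, because
the coin is deterministic from margin t on. -/
theorem heavyPath_almostSurely (ε : ℝ) {t : ℕ} (ht : 1 ≤ t) (s : Multiset ℕ) (h v : ℕ) :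
    (heavyPath ε t s h v).AlmostSurely fun p => p / 2 ^ h = v ∧ ∀ g < h,
      nodeWeight s (g + 1) (p / 2 ^ (g + 1)) ≤ 2 * nodeWeight s g (p / 2 ^ g) + t := by
  induction h generalizing v with
  | zero => exact .pure (by simp)
  | succ h ih =>
    have key : ∀ w p, w / 2 = v →
        nodeWeight s (h + 1) v ≤ 2 * nodeWeight s h w + t →
        (p / 2 ^ h = w ∧ ∀ g < h,
          nodeWeight s (g + 1) (p / 2 ^ (g + 1)) ≤ 2 * nodeWeight s g (p / 2 ^ g) + t) →
        (p / 2 ^ (h + 1) = v ∧ ∀ g < h + 1,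
          nodeWeight s (g + 1) (p / 2 ^ (g + 1)) ≤ 2 * nodeWeight s g (p / 2 ^ g) + t) := by
      rintro w p hw hW ⟨hp, hg⟩
      have hp' := div_two_pow_succ_eq hp hw
      refine ⟨hp', fun g hgh => ?_⟩
      rcases Nat.lt_succ_iff_lt_or_eq.1 hgh with h' | rfl
      · exact hg g h'
      · rwa [hp', hp]
    refine .mix (fun hne => (ih (2 * v)).mono fun p => key _ p (by omega) ?_)
      (fun hne => (ih (2 * v + 1)).mono fun p => key _ p (by omega) ?_)
    · by_contra hlt
      refine hne ?_
      rw [truncatedLogistic_of_le_neg ht]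
      · simp
      · rw [nodeWeight_succ] at hlt
        unfold nodeBalance
        omega
    · by_contra hlt
      refine hne ?_
      rw [truncatedLogistic_of_le]
      · simp
      · rw [nodeWeight_succ] at hlt
        unfold nodeBalance
        omega

theorem exp_le_three {x : ℝ} (hx : x ≤ 1) : Real.exp x ≤ 3 :=
  (Real.exp_le_exp.2 hx).trans (by have := Real.exp_one_lt_d9; linarith)

/-- Choosing a path privately: only the nodes with nearly balanced children contribute to the
privacy loss, and each of them halves the weight. The functions to be averaged may not depend on
the part of the path below nodes of weight at most `t + 1 + c`. -/
theorem heavyPath_le {ε δ a b : ℝ} (hε : 0 ≤ ε) (hε1 : ε ≤ 1) {t : ℕ} (ht : 1 ≤ t)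
    (hδ : Real.exp (-(ε * t)) ≤ δ) {s₁ s₂ u : Multiset ℕ}
    (h12 : ∀ h v, |nodeBalance s₁ h v - nodeBalance s₂ h v| ≤ 1)
    (h1u : ∀ h v, |nodeBalance s₁ h v - nodeBalance u h v| ≤ 1)
    (h2u : ∀ h v, |nodeBalance s₂ h v - nodeBalance u h v| ≤ 1)
    (c : ℕ) {F G : ℕ → ℝ} (hG0 : ∀ p, 0 ≤ G p) (hG1 : ∀ p, G p ≤ 1)
    (r h v : ℕ) (hr : a + r * ε ≤ 1)
    (hw : nodeWeight u h v ≤ t + 1 + 2 ^ r * c)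
    (hFG : ∀ p, p / 2 ^ h = v → F p ≤ Real.exp a * G p + b)
    (hconst : ∀ p p' g, p / 2 ^ h = v → g ≤ h → p / 2 ^ g = p' / 2 ^ g →
      nodeWeight u g (p / 2 ^ g) ≤ t + 1 + c → F p = F p' ∧ G p = G p') :
    (heavyPath ε t s₁ h v).E F ≤
      Real.exp (a + r * ε) * (heavyPath ε t s₂ h v).E G + (b + 24 * r * δ) := by
  have hδ0 : 0 ≤ δ := (Real.exp_pos _).le.trans hδ
  have hrε : 0 ≤ r * ε := by positivity
  have hexp : Real.exp a ≤ Real.exp (a + r * ε) := Real.exp_le_exp.2 (by linarith)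
  induction h generalizing r v with
  | zero =>
    have h1 := hFG v (by simp)
    have h2 := mul_le_mul_of_nonneg_right hexp (hG0 v)
    have h3 : 0 ≤ 24 * r * δ := by positivity
    simp only [heavyPath, Expectation.pure_E]
    linarith
  | succ h ih =>
    -- At a light node F and G are constant on the leaves below, so the two random paths need no
    -- comparison.
    by_cases hk : nodeWeight u (h + 1) v ≤ t + 1 + c
    · set p₀ := v * 2 ^ (h + 1)
      have hp₀ : p₀ / 2 ^ (h + 1) = v := Nat.mul_div_cancel _ (by positivity)
      have hF : (heavyPath ε t s₁ (h + 1) v).E F = F p₀ :=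
        (heavyPath_almostSurely ε ht s₁ (h + 1) v).eq_const fun p hp =>
          (hconst p p₀ (h + 1) hp.1 le_rfl (by rw [hp.1, hp₀]) (by rwa [hp.1])).1
      have hG : (heavyPath ε t s₂ (h + 1) v).E G = G p₀ :=
        (heavyPath_almostSurely ε ht s₂ (h + 1) v).eq_const fun p hp =>
          (hconst p p₀ (h + 1) hp.1 le_rfl (by rw [hp.1, hp₀]) (by rwa [hp.1])).2
      rw [hF, hG]
      have h1 := hFG p₀ hp₀
      have h2 := mul_le_mul_of_nonneg_right hexp (hG0 p₀)
      have h3 : 0 ≤ 24 * r * δ := by positivity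
      linarith
    · have child : ∀ w, w / 2 = v → ∀ r' : ℕ, a + r' * ε ≤ 1 →
          nodeWeight u h w ≤ t + 1 + 2 ^ r' * c →
          (heavyPath ε t s₁ h w).E F ≤
            Real.exp (a + r' * ε) * (heavyPath ε t s₂ h w).E G + (b + 24 * r' * δ) := by
        intro w hwv r' hr' hw'
        have hr0 : 0 ≤ r' * ε := by positivity
        exact ih r' w hr' hw' (fun p hp => hFG p (div_two_pow_succ_eq hp hwv))
          (fun p p' g hp hg => hconst p p' g (div_two_pow_succ_eq hp hwv) (by omega)) hr0
          (Real.exp_le_exp.2 (by linarith))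
      have hsum := nodeWeight_succ u h v
      simp only [heavyPath, Expectation.mix_E]
      have e12 := abs_le.1 (h12 h v)
      have e1u := abs_le.1 (h1u h v)
      have e2u := abs_le.1 (h2u h v)
      -- Margin t + 1 in u leaves margin t with the same sign in s₁ and s₂: both coins are
      -- deterministic and agree, at no cost.
      rcases le_or_gt ((t : ℤ) + 1) |nodeBalance u h v| with hdet | hbal
      · rcases le_abs.1 hdet with hpos | hneg
        · rw [truncatedLogistic_of_le (show (t : ℤ) ≤ nodeBalance s₁ h v by omega),
            truncatedLogistic_of_le (show (t : ℤ) ≤ nodeBalance s₂ h v by omega)]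
          simpa using child (2 * v) (by omega) r hr (by omega)
        · rw [truncatedLogistic_of_le_neg ht (show nodeBalance s₁ h v ≤ -t by omega),
            truncatedLogistic_of_le_neg ht (show nodeBalance s₂ h v ≤ -t by omega)]
          simpa using child (2 * v + 1) (by omega) r hr (by omega)
      -- Nearly balanced children: the bound 2 ^ (r + 1) * c on the weight in excess of t + 1 halves
      -- for each child, which pays for one unit of r. For r = 0 the node would be light.
      · obtain ⟨hb1, hb2⟩ := abs_lt.1 hbal
        unfold nodeBalance at hb1 hb2
        cases r with
        | zero => simp at hw; omega
        | succ r =>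
          have hpow : 2 ^ (r + 1) * c = 2 * (2 ^ r * c) := by ring
          rw [hpow] at hw
          push_cast at hr hrε ⊢
          have hr' : a + r * ε ≤ 1 := by linarith
          have c1 := child (2 * v) (by omega) r hr' (by omega)
          have c2 := child (2 * v + 1) (by omega) r hr' (by omega)
          set A := (heavyPath ε t s₂ h (2 * v)).E G
          set B := (heavyPath ε t s₂ h (2 * v + 1)).E G
          have hA0 : 0 ≤ A := Expectation.nonneg _ _ hG0
          have hB0 : 0 ≤ B := Expectation.nonneg _ _ hG0
          have hA1 : A ≤ 1 := Expectation.le_one _ hG1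
          have hB1 : B ≤ 1 := Expectation.le_one _ hG1
          have hmix := truncatedLogistic_mix_le hε hε1 hδ (h12 h v) hA0 hA1 hB0 hB1
          obtain ⟨hp0, hp1⟩ := (truncatedLogistic ε t (nodeBalance s₁ h v)).2
          -- The coin's error 8δ gets multiplied by an exponential of at most 3, whence 24δ per unit
          -- of r.
          have he3 := exp_le_three hr'
          have he0 := Real.exp_pos (a + r * ε)
          rw [show a + ((r : ℝ) + 1) * ε = (a + r * ε) + ε by ring, Real.exp_add (a + r * ε) ε]
          have d1 := mul_le_mul_of_nonneg_left c1 hp0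
          have d2 := mul_le_mul_of_nonneg_left c2 (sub_nonneg.2 hp1)
          have d3 := mul_le_mul_of_nonneg_left hmix he0.le
          have d4 := mul_le_mul_of_nonneg_right he3 (show 0 ≤ 8 * δ by positivity)
          linarith

/-! ### Depth and the choice of an endpoint -/

/-- The depth of `y` in the database `s`: the number of elements that have to be removed from `s`
such that `y` is no longer an interior point. -/
def depth (s : Multiset ℕ) (y : ℕ) : ℕ := min (s.countP (· ≤ y)) (s.countP (y ≤ ·))

/-- The node `p / 2 ^ g` of height `g` as a half-open interval: its left endpoint. -/
def nodeMin (p g : ℕ) : ℕ := p / 2 ^ g * 2 ^ g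

/-- The right endpoint of the node `p / 2 ^ g` of height `g`. -/
def nodeMax (p g : ℕ) : ℕ := p / 2 ^ g * 2 ^ g + (2 ^ g - 1)

/-- Choose privately between the endpoints of the node `p / 2 ^ g`. -/
noncomputable def chooseEndpoint (ε : ℝ) (t : ℕ) (s : Multiset ℕ) (p g : ℕ) : Expectation ℕ :=
  .mix (truncatedLogistic ε t ((depth s (nodeMin p g) : ℤ) - depth s (nodeMax p g)))
    (.pure (nodeMin p g)) (.pure (nodeMax p g))

/-- `y` lies between the smallest and the largest element of `s`. -/
def IsBetween (s : Multiset ℕ) (y : ℕ) : Prop := (∃ x ∈ s, x ≤ y) ∧ ∃ x ∈ s, y ≤ x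

theorem isBetween_iff {s : Multiset ℕ} {y : ℕ} : IsBetween s y ↔ 0 < depth s y := by
  rw [depth, lt_min_iff, Multiset.countP_pos, Multiset.countP_pos, IsBetween]

theorem depth_cons (a : ℕ) (s : Multiset ℕ) (y : ℕ) :
    depth s y ≤ depth (a ::ₘ s) y ∧ depth (a ::ₘ s) y ≤ depth s y + 1 := by
  unfold depth
  rw [Multiset.countP_cons, Multiset.countP_cons]
  split_ifs <;> omega

theorem chooseEndpoint_congr {ε : ℝ} {t : ℕ} {s : Multiset ℕ} {p p' g : ℕ}
    (h : p / 2 ^ g = p' / 2 ^ g) : chooseEndpoint ε t s p g = chooseEndpoint ε t s p' g := by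
  unfold chooseEndpoint nodeMin nodeMax
  rw [h]

theorem chooseEndpoint_le {ε δ : ℝ} (hε : 0 ≤ ε) (hε1 : ε ≤ 1) {t : ℕ}
    (hδ : Real.exp (-(ε * t)) ≤ δ) {s₁ s₂ : Multiset ℕ}
    (h : (∃ a, s₂ = a ::ₘ s₁) ∨ ∃ a, s₁ = a ::ₘ s₂) (p g : ℕ) {f : ℕ → ℝ}
    (hf0 : ∀ y, 0 ≤ f y) (hf1 : ∀ y, f y ≤ 1) :
    (chooseEndpoint ε t s₁ p g).E f ≤ Real.exp ε * (chooseEndpoint ε t s₂ p g).E f + 8 * δ := by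
  simp only [chooseEndpoint, Expectation.mix_E, Expectation.pure_E]
  refine truncatedLogistic_mix_le hε hε1 hδ ?_ (hf0 _) (hf1 _) (hf0 _) (hf1 _)
  rw [abs_le]
  rcases h with ⟨a, rfl⟩ | ⟨a, rfl⟩
  · have h1 := depth_cons a s₁ (nodeMin p g)
    have h2 := depth_cons a s₁ (nodeMax p g)
    omega
  · have h1 := depth_cons a s₂ (nodeMin p g)
    have h2 := depth_cons a s₂ (nodeMax p g)
    omega

/-- If one endpoint has depth 0, the other wins by at least t, and the truncated coin picks it
surely. -/
theorem chooseEndpoint_almostSurely {ε : ℝ} {t : ℕ} (ht : 1 ≤ t) {s : Multiset ℕ} {p g : ℕ}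
    (h : t ≤ depth s (nodeMin p g) ∨ t ≤ depth s (nodeMax p g)) :
    (chooseEndpoint ε t s p g).AlmostSurely (IsBetween s) := by
  refine .mix (fun hne => .pure ?_) (fun hne => .pure ?_) <;> rw [isBetween_iff] <;>
    by_contra hd <;> refine hne ?_
  · rw [truncatedLogistic_of_le_neg ht (by omega)]
    simp
  · rw [truncatedLogistic_of_le (by omega)]
    simp

theorem div_two_pow_eq_iff (x p g : ℕ) :
    x / 2 ^ g = p / 2 ^ g ↔ nodeMin p g ≤ x ∧ x ≤ nodeMax p g := by
  have h1 : 0 < 2 ^ g := by positivity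
  unfold nodeMin nodeMax
  rw [Nat.div_eq_iff h1]
  omega

/-- Entries forking at height g ≥ 1 or more lie outside the node, so at least t of them are on one
side. The endpoint on that side has these on its outer side and the t entries of the node on its
inner side. -/
theorem le_depth_endpoint {t : ℕ} {s : Multiset ℕ} {p g : ℕ}
    (hw : t ≤ nodeWeight s g (p / 2 ^ g))
    (hout : 2 * t ≤ s.countP (fun x => g ≤ forkHeight p x)) :
    t ≤ depth s (nodeMin p g) ∨ t ≤ depth s (nodeMax p g) := by
  have hmono : ∀ (P Q : ℕ → Prop) [DecidablePred P] [DecidablePred Q], (∀ x, P x → Q x) →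
      s.countP P ≤ s.countP Q := by
    intro P Q _ _ hPQ
    rw [Multiset.countP_eq_card_filter, Multiset.countP_eq_card_filter]
    exact Multiset.card_le_card (Multiset.monotone_filter_right _ hPQ)
  have hin1 : nodeWeight s g (p / 2 ^ g) ≤ s.countP (nodeMin p g ≤ ·) :=
    hmono _ _ fun x hx => ((div_two_pow_eq_iff x p g).1 hx).1
  have hin2 : nodeWeight s g (p / 2 ^ g) ≤ s.countP (· ≤ nodeMax p g) :=
    hmono _ _ fun x hx => ((div_two_pow_eq_iff x p g).1 hx).2
  unfold depth
  -- Every entry has fork height at least 0, so `hout` says nothing for g = 0; but then the node is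
  -- a single leaf repeated at least t times.
  rcases Nat.eq_zero_or_pos g with rfl | hg
  · left
    have hin3 : nodeWeight s 0 (p / 2 ^ 0) ≤ s.countP (· ≤ nodeMin p 0) :=
      hmono _ _ fun x hx => ((div_two_pow_eq_iff x p 0).1 hx).2.trans (by simp [nodeMin, nodeMax])
    omega
  · have hsplit : s.countP (fun x => g ≤ forkHeight p x) ≤
        s.countP (· ≤ nodeMin p g) + s.countP (nodeMax p g ≤ ·) := by
      have hunion := congrArg Multiset.card (Multiset.filter_add_filter
        (fun x => x ≤ nodeMin p g) (fun x => nodeMax p g ≤ x) s)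
      rw [Multiset.card_add, Multiset.card_add] at hunion
      simp only [Multiset.countP_eq_card_filter]
      rw [hunion]
      refine (Multiset.card_le_card (Multiset.monotone_filter_right _ fun x hx => ?_)).trans
        (Nat.le_add_right _ _)
      by_contra hcon
      have : forkHeight p x ≤ g - 1 := by
        rw [forkHeight_le_iff, Nat.sub_add_cancel hg, div_two_pow_eq_iff]
        omega
      omega
    omega

/-! ### Lifting a mechanism from d to 2 ^ d -/

/-- A mechanism `M` that finds, with probability one, an interior point of databases of at least
`n` elements of `{0, ..., T - 1}`, and that is differentially private with respect to adding and
removing elements as long as the size of the database is between `n` and `N`. -/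
structure IsInteriorPointMechanism (T n N : ℕ) (ε δ : ℝ) (M : Multiset ℕ → Expectation ℕ) :
    Prop where
  almostSurely : ∀ s, (∀ x ∈ s, x < T) → n ≤ s.card → (M s).AlmostSurely (IsBetween s)
  le_cons : ∀ s a, (∀ x ∈ a ::ₘ s, x < T) → n ≤ s.card → s.card < N → ∀ f : ℕ → ℝ,
    (∀ y, 0 ≤ f y) → (∀ y, f y ≤ 1) → (M s).E f ≤ Real.exp ε * (M (a ::ₘ s)).E f + δ
  cons_le : ∀ s a, (∀ x ∈ a ::ₘ s, x < T) → n ≤ s.card → s.card < N → ∀ f : ℕ → ℝ,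
    (∀ y, 0 ≤ f y) → (∀ y, f y ≤ 1) → (M (a ::ₘ s)).E f ≤ Real.exp ε * (M s).E f + δ

theorem isInteriorPointMechanism_pure (N : ℕ) :
    IsInteriorPointMechanism 1 1 N 0 0 (fun _ => .pure 0) where
  almostSurely s hs hn := by
    obtain ⟨x, hx⟩ := Multiset.card_pos_iff_exists_mem.1 hn
    refine .pure ⟨⟨x, hx, ?_⟩, ⟨x, hx, Nat.zero_le _⟩⟩
    have := hs x hx
    omega
  le_cons := by simp
  cons_le := by simp

/-- The mechanism `M` on `{0, ..., d - 1}`, lifted to a mechanism on `{0, ..., 2 ^ d - 1}`: find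
the height at which to cut a random path that follows the heavier child, and choose an endpoint
of the node at this height. -/
noncomputable def liftMechanism (ε : ℝ) (t k m d : ℕ) (M : Multiset ℕ → Expectation ℕ)
    (s : Multiset ℕ) : Expectation ℕ :=
  (heavyPath ε t s d 0).bind fun p =>
    (M (forkDatabase k m s p)).bind fun g => chooseEndpoint ε t s p g

section lift

variable {ε ε' δ δ' : ℝ} {t d n N r : ℕ} {M : Multiset ℕ → Expectation ℕ}

theorem forkDatabase_lt {k m : ℕ} {s : Multiset ℕ} {p : ℕ} (hd : 1 ≤ d)
    (hs : ∀ x ∈ s, x < 2 ^ d) (hp : p / 2 ^ d = 0) : ∀ x ∈ forkDatabase k m s p, x < d := by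
  intro g hg
  obtain ⟨x, hx, rfl⟩ := exists_of_mem_forkDatabase hg
  exact forkHeight_lt hd (by simpa [Nat.div_eq_zero_iff] using hp) (hs x hx)

/-- The node at height g + 1 has weight above 5t + 1, which is at most twice the weight at height g
plus t; so the node at height g has weight at least t. The other trimming leaves more than 2t
entries with fork height at least g. -/
theorem liftMechanism_almostSurely (hM : IsInteriorPointMechanism d n N ε' δ' M) (hd : 1 ≤ d)
    (ht : 1 ≤ t) {s : Multiset ℕ} (hs : ∀ x ∈ s, x < 2 ^ d) (hn : n + (7 * t + 1) ≤ s.card) :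
    (liftMechanism ε t (5 * t + 1) (2 * t) d M s).AlmostSurely (IsBetween s) := by
  refine (heavyPath_almostSurely ε ht s d 0).bind fun p hp => ?_
  refine (hM.almostSurely _ (forkDatabase_lt hd hs hp.1)
    (by rw [card_forkDatabase]; omega)).bind fun g hg => ?_
  obtain ⟨⟨y, hy, hyg⟩, ⟨z, hz, hgz⟩⟩ := hg
  apply chooseEndpoint_almostSurely ht
  apply le_depth_endpoint
  · have h1 := lt_nodeWeight_of_forkDatabase hy hyg
    have h2 := hp.2 g (hgz.trans_lt (forkDatabase_lt hd hs hp.1 z hz))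
    omega
  · exact (lt_countP_of_forkDatabase hz hgz).le

/-- Almost surely the node at height g + 1 has weight above k, so g ≥ h and the endpoints depend
only on the common part of the paths. A failure event of positive probability would break this
equality. -/
theorem liftMechanism_const (hM : IsInteriorPointMechanism d n N ε' δ' M) (hd : 1 ≤ d)
    {k m : ℕ} {s : Multiset ℕ} (hs : ∀ x ∈ s, x < 2 ^ d) (hn : n + (k + m) ≤ s.card)
    {p p' h : ℕ} (hp : p / 2 ^ d = 0) (hpp : p / 2 ^ h = p' / 2 ^ h)
    (hw : nodeWeight s h (p / 2 ^ h) ≤ k) (f : ℕ → ℝ) :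
    (M (forkDatabase k m s p)).E (fun g => (chooseEndpoint ε t s p g).E f) =
      (M (forkDatabase k m s p')).E (fun g => (chooseEndpoint ε t s p' g).E f) := by
  rw [← forkDatabase_congr hpp hw]
  refine (hM.almostSurely _ (forkDatabase_lt hd hs hp)
    (by rw [card_forkDatabase]; omega)).congr fun g hg => ?_
  obtain ⟨⟨y, hy, hyg⟩, -⟩ := hg
  have h1 := lt_nodeWeight_of_forkDatabase hy hyg
  have hgh : h ≤ g := by
    by_contra hlt
    have := nodeWeight_mono (s := s) (p := p) (show g + 1 ≤ h by omega)
    omega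
  rw [chooseEndpoint_congr (div_two_pow_eq_of_le hgh hpp)]

theorem liftMechanism_le (hM : IsInteriorPointMechanism d n N ε' δ' M) (hd : 1 ≤ d)
    (hε : 0 ≤ ε) (hε' : 0 ≤ ε') (ht : 1 ≤ t) (hδ : Real.exp (-(ε * t)) ≤ δ)
    (hsum : ε' + (r + 1) * ε ≤ 1) (hN : N ≤ t + 1 + 2 ^ r * (4 * t))
    {s₁ s₂ u : Multiset ℕ} (hs : ∀ x ∈ u, x < 2 ^ d) (hu : u.card ≤ N)
    (hn₁ : n + (7 * t + 1) ≤ s₁.card) (hn₂ : n + (7 * t + 1) ≤ s₂.card)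
    (h : (u = s₂ ∧ ∃ a, s₂ = a ::ₘ s₁) ∨ (u = s₁ ∧ ∃ a, s₁ = a ::ₘ s₂))
    {f : ℕ → ℝ} (hf0 : ∀ y, 0 ≤ f y) (hf1 : ∀ y, f y ≤ 1) :
    (liftMechanism ε t (5 * t + 1) (2 * t) d M s₁).E f ≤
      Real.exp (ε' + (r + 1) * ε) * (liftMechanism ε t (5 * t + 1) (2 * t) d M s₂).E f +
        (δ' + 24 * (r + 1) * δ) := by
  have hδ0 : 0 ≤ δ := (Real.exp_pos _).le.trans hδ
  have hrε : 0 ≤ r * ε := by positivity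
  have hle₁ : s₁ ≤ u := by
    rcases h with ⟨rfl, a, rfl⟩ | ⟨rfl, -⟩
    exacts [Multiset.le_cons_self _ _, le_rfl]
  have hle₂ : s₂ ≤ u := by
    rcases h with ⟨rfl, -⟩ | ⟨rfl, a, rfl⟩
    exacts [le_rfl, Multiset.le_cons_self _ _]
  have hs₁ : ∀ x ∈ s₁, x < 2 ^ d := fun x hx => hs x (Multiset.mem_of_le hle₁ hx)
  have hs₂ : ∀ x ∈ s₂, x < 2 ^ d := fun x hx => hs x (Multiset.mem_of_le hle₂ hx)
  have hbal : ∀ h' v, |nodeBalance s₁ h' v - nodeBalance s₂ h' v| ≤ 1 := by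
    intro h' v
    rcases h with ⟨-, a, rfl⟩ | ⟨-, a, rfl⟩
    · rw [abs_sub_comm]; exact abs_nodeBalance_cons _ _ _ _
    · exact abs_nodeBalance_cons _ _ _ _
  have hbal₁ : ∀ h' v, |nodeBalance s₁ h' v - nodeBalance u h' v| ≤ 1 := by
    intro h' v
    rcases h with ⟨rfl, -⟩ | ⟨rfl, -⟩
    exacts [hbal h' v, by simp]
  have hbal₂ : ∀ h' v, |nodeBalance s₂ h' v - nodeBalance u h' v| ≤ 1 := by
    intro h' v
    rcases h with ⟨rfl, -⟩ | ⟨rfl, -⟩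
    exacts [by simp, by rw [abs_sub_comm]; exact hbal h' v]
  set F : Multiset ℕ → ℕ → ℝ := fun s p =>
    (M (forkDatabase (5 * t + 1) (2 * t) s p)).E fun g => (chooseEndpoint ε t s p g).E f with hF
  have hc0 : ∀ s p g, 0 ≤ (chooseEndpoint ε t s p g).E f := fun s p g =>
    Expectation.nonneg _ _ hf0
  have hc1 : ∀ s p g, (chooseEndpoint ε t s p g).E f ≤ 1 := fun s p g =>
    Expectation.le_one _ hf1
  have hweight : ∀ s ≤ u, ∀ g v, nodeWeight s g v ≤ nodeWeight u g v := fun s hsu g v =>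
    Multiset.countP_le_of_le _ hsu
  -- For a fixed path the loss is ε' for the given mechanism, whose database changes by one element,
  -- plus ε for the endpoint.
  have hpoint : ∀ p, p / 2 ^ d = 0 →
      F s₁ p ≤ Real.exp (ε' + ε) * F s₂ p + (δ' + 24 * δ) := by
    intro p hp
    have h1 : F s₁ p ≤ Real.exp ε' * (M (forkDatabase (5 * t + 1) (2 * t) s₂ p)).E
        (fun g => (chooseEndpoint ε t s₁ p g).E f) + δ' := by
      rcases h with ⟨rfl, a, rfl⟩ | ⟨rfl, a, rfl⟩
      · obtain ⟨b, hb⟩ := exists_forkDatabase_cons (5 * t + 1) (2 * t) a s₁ p (by omega)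
        have hlt := forkDatabase_lt (k := 5 * t + 1) (m := 2 * t) hd hs hp
        rw [hb] at hlt ⊢
        rw [Multiset.card_cons] at hu
        exact hM.le_cons _ _ hlt (by rw [card_forkDatabase]; omega)
          (by rw [card_forkDatabase]; omega) _ (hc0 _ p) (hc1 _ p)
      · obtain ⟨b, hb⟩ := exists_forkDatabase_cons (5 * t + 1) (2 * t) a s₂ p (by omega)
        have hlt := forkDatabase_lt (k := 5 * t + 1) (m := 2 * t) hd hs hp
        simp only [hF]
        rw [hb] at hlt ⊢
        rw [Multiset.card_cons] at hu
        exact hM.cons_le _ _ hlt (by rw [card_forkDatabase]; omega)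
          (by rw [card_forkDatabase]; omega) _ (hc0 _ p) (hc1 _ p)
    have h2 : (M (forkDatabase (5 * t + 1) (2 * t) s₂ p)).E
        (fun g => (chooseEndpoint ε t s₁ p g).E f) ≤ Real.exp ε * F s₂ p + 8 * δ := by
      refine Expectation.le_affine _ fun g => ?_
      refine chooseEndpoint_le hε (by nlinarith) hδ ?_ p g hf0 hf1
      rcases h with ⟨-, h⟩ | ⟨-, h⟩
      exacts [.inl h, .inr h]
    have h3 : Real.exp ε' ≤ 3 := exp_le_three (by nlinarith)
    have h4 := mul_le_mul_of_nonneg_left h2 (Real.exp_pos ε').le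
    rw [Real.exp_add]
    nlinarith
  -- With c = 4t the light threshold t + 1 + c is the trimming parameter 5t + 1.
  have hpath := heavyPath_le (a := ε' + ε) (F := F s₁) (G := F s₂) hε (by nlinarith) ht hδ
    hbal hbal₁ hbal₂ (4 * t) (fun p => Expectation.nonneg _ _ (hc0 _ p))
    (fun p => Expectation.le_one _ (hc1 _ p)) r d 0 (by linarith)
    (((nodeWeight_le_card _ _ _).trans hu).trans hN) hpoint
    (fun p p' g hp _ hpp hw =>
      ⟨liftMechanism_const hM hd hs₁ (by omega) hp hpp
        ((hweight _ hle₁ _ _).trans (hw.trans (by omega))) f,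
      liftMechanism_const hM hd hs₂ (by omega) hp hpp
        ((hweight _ hle₂ _ _).trans (hw.trans (by omega))) f⟩)
  have e1 : ε' + ε + r * ε = ε' + (r + 1) * ε := by ring
  rw [e1] at hpath
  refine hpath.trans (le_of_eq ?_)
  simp only [liftMechanism, Expectation.bind_E, hF]
  ring

theorem isInteriorPointMechanism_lift (hM : IsInteriorPointMechanism d n N ε' δ' M) (hd : 1 ≤ d)
    (hε : 0 ≤ ε) (hε' : 0 ≤ ε') (ht : 1 ≤ t) (hδ : Real.exp (-(ε * t)) ≤ δ)
    (hsum : ε' + (r + 1) * ε ≤ 1) (hN : N ≤ t + 1 + 2 ^ r * (4 * t)) :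
    IsInteriorPointMechanism (2 ^ d) (n + (7 * t + 1)) N (ε' + (r + 1) * ε)
      (δ' + 24 * (r + 1) * δ) (liftMechanism ε t (5 * t + 1) (2 * t) d M) where
  almostSurely s hs hn := liftMechanism_almostSurely hM hd ht hs hn
  le_cons s a hs hn hN' f hf0 hf1 :=
    liftMechanism_le hM hd hε hε' ht hδ hsum hN hs (by rw [Multiset.card_cons]; omega) hn
      (by rw [Multiset.card_cons]; omega) (.inl ⟨rfl, a, rfl⟩) hf0 hf1
  cons_le s a hs hn hN' f hf0 hf1 :=
    liftMechanism_le hM hd hε hε' ht hδ hsum hN hs (by rw [Multiset.card_cons]; omega)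
      (by rw [Multiset.card_cons]; omega) hn (.inr ⟨rfl, a, rfl⟩) hf0 hf1

end lift

/-! ### Iterating the lift; the iterated logarithm -/

/-- The tower of twos of height `j`. -/
def twoTower : ℕ → ℕ
  | 0 => 1
  | j + 1 => 2 ^ twoTower j

theorem one_le_twoTower (j : ℕ) : 1 ≤ twoTower j := by
  cases j with
  | zero => exact le_rfl
  | succ j => exact Nat.one_le_two_pow

theorem exists_isInteriorPointMechanism {ε δ : ℝ} {t r N : ℕ} (hε : 0 ≤ ε) (ht : 1 ≤ t)
    (hδ : Real.exp (-(ε * t)) ≤ δ) (hN : N ≤ t + 1 + 2 ^ r * (4 * t)) (j : ℕ)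
    (hj : j * ((r + 1) * ε) ≤ 1) :
    ∃ M, IsInteriorPointMechanism (twoTower j) (1 + j * (7 * t + 1)) N (j * ((r + 1) * ε))
      (j * (24 * (r + 1) * δ)) M := by
  induction j with
  | zero => exact ⟨_, by simpa [twoTower] using isInteriorPointMechanism_pure N⟩
  | succ j ih =>
    have hrε : 0 ≤ (r + 1) * ε := by positivity
    push_cast at hj
    obtain ⟨M, hM⟩ := ih (by linarith)
    refine ⟨liftMechanism ε t (5 * t + 1) (2 * t) (twoTower j) M, ?_⟩
    · have := isInteriorPointMechanism_lift hM (one_le_twoTower j) hε (by positivity) ht hδ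
        (by linarith) hN
      convert this using 1
      · rfl
      · ring
      · push_cast; ring
      · push_cast; ring

/-- The function `logb 2` reaches a value at most one after finitely many iterations. -/
theorem exists_iterate_logb_le_one (n : ℕ) :
    ∀ x : ℝ, x ≤ n → ∃ k, (Real.logb 2)^[k] x ≤ 1 := by
  induction n with
  | zero => exact fun x hx => ⟨0, by simpa using hx.trans (by norm_num)⟩
  | succ n ih =>
    intro x hx
    rcases le_or_gt x 1 with h1 | h1
    · exact ⟨0, h1⟩
    rcases le_or_gt x 2 with h2 | h2
    · refine ⟨1, ?_⟩
      rw [Function.iterate_one, Real.logb_le_iff_le_rpow (by norm_num) (by linarith)]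
      simpa using h2
    -- Bernoulli's inequality gives x ≤ 2 ^ (x - 1) for x ≥ 2, so the logarithm lowers x by at least
    -- one.
    · have hb := one_add_mul_self_le_rpow_one_add (s := 1) (by norm_num) (p := x - 1) (by linarith)
      have hlog : Real.logb 2 x ≤ x - 1 := by
        rw [Real.logb_le_iff_le_rpow (by norm_num) (by linarith)]
        norm_num at hb
        exact hb
      push_cast at hx
      obtain ⟨k, hk⟩ := ih (Real.logb 2 x) (by linarith)
      exact ⟨k + 1, hk⟩

theorem le_twoTower_of_iterate_logb_le_one (k : ℕ) :
    ∀ x : ℝ, (Real.logb 2)^[k] x ≤ 1 → x ≤ twoTower k := by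
  induction k with
  | zero => intro x hx; simpa [twoTower] using hx
  | succ k ih =>
    intro x hx
    have h := ih _ hx
    -- For x ≤ 0 the value of `Real.logb` carries no information on the size of x.
    rcases le_or_gt x 0 with h0 | h0
    · exact h0.trans (Nat.cast_nonneg _)
    · rw [Real.logb_le_iff_le_rpow (by norm_num) h0, Real.rpow_natCast] at h
      simpa [twoTower] using h

theorem le_twoTower_logStar (N : ℕ) : N ≤ twoTower (logStar N) := by
  have h : (Real.logb 2)^[logStar N] (N : ℝ) ≤ 1 :=
    Nat.sInf_mem (s := {k : ℕ | (Real.logb 2)^[k] (N : ℝ) ≤ 1})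
      (exists_iterate_logb_le_one N N le_rfl)
  exact_mod_cast le_twoTower_of_iterate_logb_le_one _ _ h

/-! ### From mechanisms on multisets to algorithms on databases -/

/-- The probability mass function of an expectation functional on a finite type. -/
noncomputable def Expectation.toPMF {Y : Type*} [Fintype Y] (P : Expectation Y) : PMF Y := by
  classical
  exact PMF.ofFintype (fun y => ENNReal.ofReal (P.E (Pi.single y 1))) <| by
    rw [← ENNReal.ofReal_sum_of_nonneg, ← map_sum]
    · rw [Finset.univ_sum_single (fun _ : Y => (1 : ℝ)), P.one, ENNReal.ofReal_one]
    · intro y _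
      refine P.nonneg _ fun z => ?_
      rw [Pi.single_apply]
      split_ifs <;> norm_num

theorem Expectation.toPMF_toOuterMeasure {Y : Type*} [Fintype Y] (P : Expectation Y) (T : Set Y) :
    P.toPMF.toOuterMeasure T = ENNReal.ofReal (P.E (T.indicator fun _ => 1)) := by
  classical
  rw [PMF.toOuterMeasure_apply_fintype]
  have h : ∀ y, T.indicator (⇑P.toPMF) y =
      ENNReal.ofReal (P.E (Pi.single y (T.indicator (fun _ => (1 : ℝ)) y))) := by
    intro y
    by_cases hy : y ∈ T
    · simp only [Set.indicator_of_mem hy, Expectation.toPMF, PMF.ofFintype_apply]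
    · simp [Set.indicator_of_notMem hy]
  simp only [h]
  rw [← ENNReal.ofReal_sum_of_nonneg, ← map_sum, Finset.univ_sum_single]
  intro y _
  refine P.nonneg _ fun z => ?_
  rw [Pi.single_apply]
  split_ifs
  · exact Set.indicator_nonneg (fun _ _ => zero_le_one) _
  · exact le_rfl

/-- The multiset of the entries of a database. -/
def databaseMultiset {n : ℕ} (u : Fin n → ℕ) : Multiset ℕ := Finset.univ.val.map u

theorem Neighboring.exists_cons {n : ℕ} {u u' : Fin n → ℕ} (h : Neighboring u u') :
    ∃ s a b, databaseMultiset u = a ::ₘ s ∧ databaseMultiset u' = b ::ₘ s := by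
  obtain ⟨i, hi⟩ := h
  have huniv : (Finset.univ : Finset (Fin n)).val = i ::ₘ Finset.univ.val.erase i :=
    (Multiset.cons_erase (Finset.mem_univ i)).symm
  refine ⟨(Finset.univ.val.erase i).map u, u i, u' i, ?_, ?_⟩
  · rw [databaseMultiset, huniv, Multiset.map_cons, Multiset.erase_cons_head]
  · rw [databaseMultiset, huniv, Multiset.map_cons, Multiset.erase_cons_head]
    congr 1
    refine Multiset.map_congr rfl fun j hj => (hi j ?_).symm
    exact ((Multiset.Nodup.mem_erase_iff Finset.univ.nodup).1 hj).1

theorem Neighboring.comp_castLE {X : Type*} {m n : ℕ} (hmn : m ≤ n) (hm : 0 < m)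
    {S S' : Fin n → X} (h : Neighboring S S') :
    Neighboring (S ∘ Fin.castLE hmn) (S' ∘ Fin.castLE hmn) := by
  obtain ⟨i, hi⟩ := h
  by_cases him : (i : ℕ) < m
  · refine ⟨⟨i, him⟩, fun j hj => hi _ fun e => hj ?_⟩
    ext
    simpa using congrArg Fin.val e
  -- The differing entry lies outside the prefix, so the restrictions coincide and any index serves.
  · refine ⟨⟨0, hm⟩, fun j _ => hi _ fun e => him ?_⟩
    rw [← e]
    exact j.2

/-- Replacing an entry is a removal followed by an addition; the additive errors sum to δ + e^ε δ ≤
4δ. -/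
theorem IsInteriorPointMechanism.le_of_cons_cons {T n N : ℕ} {ε δ : ℝ}
    {M : Multiset ℕ → Expectation ℕ} (hM : IsInteriorPointMechanism T n N ε δ M) (hε : ε ≤ 1)
    (hδ : 0 ≤ δ) {s : Multiset ℕ} {a b : ℕ} (ha : ∀ x ∈ a ::ₘ s, x < T)
    (hb : ∀ x ∈ b ::ₘ s, x < T) (hn : n ≤ s.card) (hN : s.card < N) {f : ℕ → ℝ}
    (hf0 : ∀ y, 0 ≤ f y) (hf1 : ∀ y, f y ≤ 1) :
    (M (a ::ₘ s)).E f ≤ Real.exp (2 * ε) * (M (b ::ₘ s)).E f + 4 * δ := by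
  have h1 := hM.cons_le s a ha hn hN f hf0 hf1
  have h2 := hM.le_cons s b hb hn hN f hf0 hf1
  have h3 := exp_le_three hε
  have h4 := mul_le_mul_of_nonneg_left h2 (Real.exp_pos ε).le
  rw [two_mul, Real.exp_add]
  nlinarith

/-- Only the first m + 1 entries are read, which keeps the database size within the range where
privacy holds. X is identified with an initial segment of ℕ, and outputs are clipped by a monotone
retraction, which preserves interior points. -/
theorem exists_pmf_of_isInteriorPointMechanism {X : Type*} [LinearOrder X] [Fintype X] [Nonempty X]
    {T m n : ℕ} {ε δ : ℝ} {M : Multiset ℕ → Expectation ℕ}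
    (hM : IsInteriorPointMechanism T m (m + 1) ε δ M) (hT : Fintype.card X ≤ T) (hε : ε ≤ 1)
    (hδ : 0 ≤ δ) (hn : m + 1 ≤ n) {β : ℝ} (hβ : 0 ≤ β) :
    ∃ A : (Fin n → X) → PMF X,
      IsDifferentiallyPrivate A (2 * ε) (4 * δ) ∧ SolvesInteriorPoint A β := by
  have hcard : 0 < Fintype.card X := Fintype.card_pos
  let e : Fin (Fintype.card X) ≃o X := monoEquivOfFin X rfl
  let i : X → ℕ := fun x => (e.symm x : ℕ)
  let p : ℕ → X := fun y => e ⟨min y (Fintype.card X - 1), by omega⟩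
  have hi : ∀ x, i x < Fintype.card X := fun x => (e.symm x).2
  have hpi : ∀ x, p (i x) = x := by
    intro x
    have : (⟨min (i x) (Fintype.card X - 1), by omega⟩ : Fin (Fintype.card X)) = e.symm x := by
      ext
      have := hi x
      simp only [i] at this ⊢
      omega
    simp only [p, this, OrderIso.apply_symm_apply]
  have hp : Monotone p := by
    intro y z hyz
    apply e.monotone
    rw [Fin.mk_le_mk]
    omega
  let D : (Fin n → X) → Multiset ℕ := fun S => databaseMultiset (i ∘ S ∘ Fin.castLE hn)
  have hD : ∀ S, ∀ x ∈ D S, x < T := by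
    intro S x hx
    obtain ⟨j, -, rfl⟩ := Multiset.mem_map.1 hx
    exact (hi _).trans_le hT
  have hDcard : ∀ S, (D S).card = m + 1 := by
    intro S
    simp [D, databaseMultiset]
  refine ⟨fun S => ((M (D S)).bind fun y => .pure (p y)).toPMF, ?_, ?_⟩
  · intro S S' hSS' U
    rw [Expectation.toPMF_toOuterMeasure, Expectation.toPMF_toOuterMeasure,
      ← ENNReal.ofReal_mul (Real.exp_pos _).le, ← ENNReal.ofReal_add _ (by positivity)]
    · apply ENNReal.ofReal_le_ofReal
      have hnb : Neighboring (i ∘ S ∘ Fin.castLE hn) (i ∘ S' ∘ Fin.castLE hn) := by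
        obtain ⟨j, hj⟩ := hSS'.comp_castLE hn (Nat.succ_pos m)
        exact ⟨j, fun l hl => congrArg i (hj l hl)⟩
      obtain ⟨s, a, b, ha, hb⟩ := hnb.exists_cons
      have hS := hD S
      have hS' := hD S'
      have hc := hDcard S
      simp only [D] at hS hS' hc ⊢
      rw [ha] at hS hc ⊢
      rw [hb] at hS' ⊢
      rw [Multiset.card_cons] at hc
      simp only [Expectation.bind_E, Expectation.pure_E]
      exact hM.le_of_cons_cons hε hδ hS hS' (by omega) (by omega)
        (fun y => Set.indicator_nonneg (fun _ _ => zero_le_one) _)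
        (fun y => Set.indicator_le_self' (fun _ _ => zero_le_one) _)
    · exact mul_nonneg (Real.exp_pos _).le
        (Expectation.nonneg _ _ fun y => Set.indicator_nonneg (fun _ _ => zero_le_one) _)
  · intro S
    rw [Expectation.toPMF_toOuterMeasure]
    apply ENNReal.ofReal_le_ofReal
    have h1 : (M (D S)).E (fun y => Set.indicator {y | IsInteriorPoint S y} (fun _ => (1 : ℝ)) (p y))
        = 1 := by
      refine (hM.almostSurely (D S) (hD S) (by rw [hDcard]; omega)).eq_const fun y hy => ?_
      refine Set.indicator_of_mem ?_ _
      obtain ⟨⟨x, hx, hxy⟩, ⟨z, hz, hyz⟩⟩ := hy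
      obtain ⟨j, -, rfl⟩ := Multiset.mem_map.1 hx
      obtain ⟨l, -, rfl⟩ := Multiset.mem_map.1 hz
      refine ⟨⟨Fin.castLE hn j, ?_⟩, ⟨Fin.castLE hn l, ?_⟩⟩
      · have := hp hxy
        simpa [hpi] using this
      · have := hp hyz
        simpa [hpi] using this
    simp only [Expectation.bind_E, Expectation.pure_E]
    rw [h1]
    linarith

/-- Releasing an entry with probability `δ` is `(ε, δ)`-differentially private. -/
theorem exists_pmf_of_large_delta {X : Type*} [LinearOrder X] [Fintype X] [Nonempty X] {n : ℕ}
    (hn : 1 ≤ n) {ε δ : ℝ} (hε : 0 ≤ ε) (hδ : 9 / 10 ≤ δ) (hδ1 : δ ≤ 1) :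
    ∃ A : (Fin n → X) → PMF X,
      IsDifferentiallyPrivate A ε δ ∧ SolvesInteriorPoint A (1 / 10) := by
  have hδ0 : 0 ≤ δ := by linarith
  obtain ⟨x₀⟩ := ‹Nonempty X›
  let A : (Fin n → X) → Expectation X := fun S =>
    .mix ⟨δ, hδ0, hδ1⟩ (.pure (S ⟨0, hn⟩)) (.pure x₀)
  have hind0 : ∀ (T : Set X) x, 0 ≤ T.indicator (fun _ => (1 : ℝ)) x :=
    fun T => Set.indicator_nonneg (fun _ _ => zero_le_one)
  have hind1 : ∀ (T : Set X) x, T.indicator (fun _ => (1 : ℝ)) x ≤ 1 :=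
    fun T => Set.indicator_le_self' (fun _ _ => zero_le_one)
  refine ⟨fun S => (A S).toPMF, ?_, ?_⟩
  · intro S S' _ T
    rw [Expectation.toPMF_toOuterMeasure, Expectation.toPMF_toOuterMeasure,
      ← ENNReal.ofReal_mul (Real.exp_pos _).le, ← ENNReal.ofReal_add _ hδ0]
    · apply ENNReal.ofReal_le_ofReal
      simp only [A, Expectation.mix_E, Expectation.pure_E]
      have h1 := mul_le_mul_of_nonneg_left (hind1 T (S ⟨0, hn⟩)) hδ0
      have h2 := mul_nonneg hδ0 (hind0 T (S' ⟨0, hn⟩))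
      have h3 := mul_nonneg (sub_nonneg.2 hδ1) (hind0 T x₀)
      have h4 := Real.one_le_exp hε
      nlinarith
    · exact mul_nonneg (Real.exp_pos _).le (Expectation.nonneg _ _ (hind0 T))
  · intro S
    rw [Expectation.toPMF_toOuterMeasure]
    apply ENNReal.ofReal_le_ofReal
    simp only [A, Expectation.mix_E, Expectation.pure_E]
    have hmem : S ⟨0, hn⟩ ∈ {y | IsInteriorPoint S y} := ⟨⟨_, le_rfl⟩, ⟨_, le_rfl⟩⟩
    have h1 : ({y | IsInteriorPoint S y} : Set X).indicator (fun _ => (1 : ℝ)) (S ⟨0, hn⟩) = 1 :=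
      Set.indicator_of_mem hmem _
    have h2 := mul_nonneg (sub_nonneg.2 hδ1) (hind0 {y | IsInteriorPoint S y} x₀)
    rw [h1]
    linarith

/-! ### Sample size and conclusion -/

/-- The number of elements that the mechanism needs is of the order of the sample complexity. -/
theorem sample_size_le {ε δ : ℝ} (hε : 0 < ε) (hε1 : ε ≤ 1) (hδ : 0 < δ) (hδ9 : δ < 9 / 10)
    {L : ℕ} (hL : 1 ≤ L) {r t : ℕ} {f : ℝ} (hf : f = 1 / ε * Real.log (1 / δ) * (L : ℝ) ^ 2)
    (hr : 2 ^ r ≤ 6 * L)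
    (ht : (t : ℝ) ≤ Real.log (96 * L * (r + 1) / δ) / (ε / (2 * L * (r + 1))) + 1) :
    2 + L * (7 * (t : ℝ) + 1) ≤ 40000 * f * Real.log (f + 2) ^ 2 := by
  set l := Real.log (1 / δ) with hl
  have hl0 : 1 / 10 ≤ l := by
    have h := Real.one_sub_inv_le_log_of_pos (show 0 < 1 / δ by positivity)
    rw [one_div, inv_inv] at h
    rw [hl, one_div δ]
    linarith
  have hL' : (1 : ℝ) ≤ L := by exact_mod_cast hL
  have hf0 : (L : ℝ) ^ 2 / 10 ≤ f := by
    have h1 : 1 ≤ 1 / ε := by rwa [le_div_iff₀ hε, one_mul]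
    have h2 : 1 * (1 / 10) ≤ 1 / ε * l := mul_le_mul h1 hl0 (by norm_num) (by positivity)
    rw [hf]
    nlinarith [mul_le_mul_of_nonneg_right h2 (sq_nonneg (L : ℝ))]
  have hg : 2 ≤ f + 2 := by nlinarith [sq_nonneg (L : ℝ)]
  have hLg : (L : ℝ) ≤ (f + 2) ^ 2 := by nlinarith [sq_nonneg ((L : ℝ) - 5 / 2)]
  set y := Real.log (f + 2) with hy
  have hlog2 := Real.log_two_gt_d9
  have hy0 : 0.69 ≤ y := by
    have := Real.log_le_log (by norm_num) hg
    linarith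
  have hr' : (2 : ℝ) ^ (r + 1) ≤ 12 * L := by
    have : (2 : ℝ) ^ r ≤ 6 * L := by exact_mod_cast hr
    rw [pow_succ]
    linarith
  -- Since f ≥ L² / 10, logarithms of powers of L are absorbed into y = log(f + 2). This is the
  -- first of the two factors y.
  have hR : ((r : ℝ) + 1) ≤ 9 * y := by
    have h1 : (2 : ℝ) ^ (r + 1) ≤ (f + 2) ^ 6 := by
      have h2 : (2 : ℝ) ^ 4 ≤ (f + 2) ^ 4 := pow_le_pow_left₀ (by norm_num) hg 4
      calc (2 : ℝ) ^ (r + 1) ≤ 2 ^ 4 * (f + 2) ^ 2 := by linarith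
        _ ≤ (f + 2) ^ 4 * (f + 2) ^ 2 := by gcongr
        _ = _ := by ring
    have h3 := Real.log_le_log (by positivity) h1
    rw [Real.log_pow, Real.log_pow] at h3
    push_cast at h3
    have h4 : (0 : ℝ) ≤ r := Nat.cast_nonneg r
    nlinarith
  have hlogR : Real.log (96 * L * (r + 1) / δ) ≤ 15 * y + l := by
    have h1 : (r : ℝ) + 1 ≤ 12 * L := by
      have : ((r + 1 : ℕ) : ℝ) ≤ 2 ^ (r + 1) := by exact_mod_cast Nat.lt_two_pow_self.le
      push_cast at this
      linarith
    have h2 : 96 * L * ((r : ℝ) + 1) ≤ (f + 2) ^ 15 := by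
      have h3 : (2 : ℝ) ^ 11 ≤ (f + 2) ^ 11 := pow_le_pow_left₀ (by norm_num) hg 11
      calc 96 * L * ((r : ℝ) + 1) ≤ 96 * L * (12 * L) := by gcongr
        _ ≤ 2 ^ 11 * (L * L) := by nlinarith
        _ ≤ (f + 2) ^ 11 * ((f + 2) ^ 2 * (f + 2) ^ 2) := by gcongr
        _ = _ := by ring
    have h3 := Real.log_le_log (by positivity) h2
    rw [Real.log_pow] at h3
    push_cast at h3
    rw [div_eq_mul_one_div, Real.log_mul (by positivity) (by positivity)]
    linarith
  -- The second factor y: l ≥ 1/10 and y ≥ 0.69 turn the sum into a product.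
  have h15 : 15 * y + l ≤ 152 * (l * y) := by nlinarith
  have hly : 0 ≤ l * y := by positivity
  have hmain : L * (t : ℝ) ≤ 2736 * f * y ^ 2 + L := by
    have h1 : Real.log (96 * L * (r + 1) / δ) / (ε / (2 * L * (r + 1))) ≤
        152 * (l * y) / ε * (2 * L * (9 * y)) := by
      rw [div_div_eq_mul_div, mul_div_right_comm]
      gcongr
      exact hlogR.trans h15
    calc L * (t : ℝ) ≤ L * (152 * (l * y) / ε * (2 * L * (9 * y)) + 1) := by
          gcongr; linarith
      _ = 2736 * f * y ^ 2 + L := by rw [hf]; ring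
  have hLf : (L : ℝ) ≤ 10 * f := by nlinarith
  have hfy : f * 0.47 ≤ f * y ^ 2 := by
    refine mul_le_mul_of_nonneg_left ?_ (by linarith)
    nlinarith
  nlinarith

theorem theorem1 :
    ∃ (C : ℝ) (k : ℕ), 0 < C ∧
      ∀ (X : Type*) [LinearOrder X] [Fintype X] (ε δ : ℝ),
        0 < ε → ε ≤ 1 → 0 < δ → δ < 1 →
        ∀ n : ℕ, 1 ≤ n →
          C * sampleTerm ε δ (Fintype.card X) *
              (Real.log (sampleTerm ε δ (Fintype.card X) + 2)) ^ k ≤ (n : ℝ) →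
          ∃ A : (Fin n → X) → PMF X,
            IsDifferentiallyPrivate A ε δ ∧ SolvesInteriorPoint A (1 / 10) := by
  refine ⟨40000, 2, by norm_num, ?_⟩
  intro X _ _ ε δ hε hε1 hδ hδ1 n hn hsize
  rcases isEmpty_or_nonempty X with hX | hX
  · have : IsEmpty (Fin n → X) := ⟨fun S => hX.elim (S ⟨0, hn⟩)⟩
    exact ⟨fun S => isEmptyElim S, fun S => isEmptyElim S, fun S => isEmptyElim S⟩
  -- As δ tends to 1, log(1/δ) vanishes and the size hypothesis may give no more than n ≥ 1.
  rcases le_or_gt (9 / 10) δ with hδ9 | hδ9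
  · exact exists_pmf_of_large_delta hn hε.le hδ9 hδ1.le
  have hT := le_twoTower_logStar (Fintype.card X)
  rw [sampleTerm] at hsize
  generalize logStar (Fintype.card X : ℝ) = L at hT hsize
  rcases Nat.eq_zero_or_pos L with rfl | hL
  · have : Subsingleton X := Fintype.card_le_one_iff_subsingleton.1 hT
    refine ⟨fun S => PMF.pure (S ⟨0, hn⟩), fun S S' _ T => ?_, fun S => ?_⟩
    · rw [Subsingleton.elim S S']
      refine (le_mul_of_one_le_left zero_le ?_).trans le_self_add
      exact ENNReal.one_le_ofReal.2 (Real.one_le_exp hε.le)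
    · have hmem : S ⟨0, hn⟩ ∈ {y | IsInteriorPoint S y} := ⟨⟨_, le_rfl⟩, ⟨_, le_rfl⟩⟩
      rw [PMF.toOuterMeasure_pure_apply, if_pos hmem]
      exact ENNReal.ofReal_le_one.2 (by norm_num)
  -- The size is about 7Lt, so 2 ^ r ≥ 3L yields `hN`; the upper bound keeps r logarithmic in L.
  obtain ⟨r, hr1, hr2⟩ : ∃ r : ℕ, 3 * L ≤ 2 ^ r ∧ 2 ^ r ≤ 6 * L := by
    refine ⟨Nat.clog 2 (3 * L), Nat.le_pow_clog (by norm_num) _, ?_⟩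
    have h1 := Nat.pow_pred_clog_lt_self (b := 2) (by norm_num) (x := 3 * L) (by omega)
    have h2 : 0 < Nat.clog 2 (3 * L) := Nat.clog_pos (by norm_num) (by omega)
    obtain ⟨q, hq⟩ := Nat.exists_eq_succ_of_ne_zero h2.ne'
    rw [hq] at h1 ⊢
    rw [Nat.pred_succ] at h1
    rw [pow_succ]
    omega
  have hL' : (1 : ℝ) ≤ L := by exact_mod_cast hL
  -- L liftings cost L(r + 1)ε₁ and 24L(r + 1)δ₁. Replacing an entry doubles the first and
  -- quadruples the second, giving exactly ε and δ.
  set ε₁ : ℝ := ε / (2 * L * (r + 1)) with hε₁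
  set δ₁ : ℝ := δ / (96 * L * (r + 1)) with hδ₁
  have hε₁0 : 0 < ε₁ := by positivity
  have hδ₁0 : 0 < δ₁ := by positivity
  have hlog : 0 < Real.log (96 * L * (r + 1) / δ) := by
    apply Real.log_pos
    rw [lt_div_iff₀ hδ]
    have : (0 : ℝ) ≤ L * r := by positivity
    nlinarith
  set t : ℕ := ⌈Real.log (96 * L * (r + 1) / δ) / ε₁⌉₊ with ht
  have ht0 : 1 ≤ t := Nat.ceil_pos.2 (by positivity)
  have ht1 : Real.log (96 * L * (r + 1) / δ) / ε₁ ≤ t := Nat.le_ceil _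
  have ht2 : (t : ℝ) ≤ Real.log (96 * L * (r + 1) / δ) / ε₁ + 1 :=
    (Nat.ceil_lt_add_one (by positivity)).le
  have hexp : Real.exp (-(ε₁ * t)) ≤ δ₁ := by
    rw [div_le_iff₀ hε₁0] at ht1
    rw [← Real.le_log_iff_exp_le hδ₁0, hδ₁, ← inv_div (96 * L * (r + 1) : ℝ) δ, Real.log_inv]
    linarith
  have hLε : L * ((r + 1) * ε₁) = ε / 2 := by rw [hε₁]; field_simp
  have hLδ : 4 * (L * (24 * (r + 1) * δ₁)) = δ := by rw [hδ₁]; field_simp; norm_num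
  have hN : 1 + L * (7 * t + 1) + 1 ≤ t + 1 + 2 ^ r * (4 * t) := by
    have h1 : 3 * L * (4 * t) ≤ 2 ^ r * (4 * t) := Nat.mul_le_mul_right _ hr1
    have h2 : L * 1 ≤ L * t := Nat.mul_le_mul_left _ ht0
    nlinarith
  obtain ⟨M, hM⟩ := exists_isInteriorPointMechanism hε₁0.le ht0 hexp hN L (by linarith)
  have hn' : 1 + L * (7 * t + 1) + 1 ≤ n := by
    have := (sample_size_le hε hε1 hδ hδ9 hL rfl hr2 ht2).trans hsize
    have h : ((1 + L * (7 * t + 1) + 1 : ℕ) : ℝ) ≤ n := by push_cast; linarith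
    exact_mod_cast h
  have := exists_pmf_of_isInteriorPointMechanism (X := X) hM hT (by linarith) (by positivity) hn'
    (β := 1 / 10) (by norm_num)
  rwa [hLδ, hLε, mul_div_cancel₀ _ (two_ne_zero)] at this
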